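/- Let $d\ge 1$ and let $A\subset\mathbb{Z}^d$ be a set with exactly $d+2$ elements such that $A-A=\{a-b: a,b\in A\}$ generates $\mathbb{Z}^d$ as an additive group. Let $\Delta_A\subset\mathbb{R}^d$ be the convex hull of $A$, let $\mathrm{vol}$ be $d$-dimensional Lebesgue measure, and for an integer $h\ge 0$ let $hA=\{a_1+\dots+a_h : a_i\in A\}$ (with $0A=\{0\}$). Then $\mathrm{vol}(\Delta_A)\cdot d!$ is an integer, and $$|hA|=\binom{h+d+1}{d+1}\qquad\text{whenever } 0\le h<\mathrm{vol}(\Delta_A)\cdot d!,$$ $$|hA|=\binom{h+d+1}{d+1}-\binom{h-\mathrm{vol}(\Delta_A)\cdot d!+d+1}{d+1}\qquad\text{whenever } h\ge \mathrm{vol}(\Delta_A)\cdot d!.$$ -/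

import Mathlib

open scoped Pointwise ENNReal

/-- The `h`-fold sumset `hA = {a₁ + ⋯ + a_h : aᵢ ∈ A}` (so that `0A = {0}`). -/
def foldSumset {d : ℕ} (h : ℕ) (A : Finset (Fin d → ℤ)) : Finset (Fin d → ℤ) :=
  (Fintype.piFinset fun _ : Fin h => A).image fun a => ∑ i, a i

/-- The convex hull `Δ_A` in `ℝ^d` of a finite set `A ⊂ ℤ^d`. -/
def hull {d : ℕ} (A : Finset (Fin d → ℤ)) : Set (Fin d → ℝ) :=
  convexHull ℝ ((fun (v : Fin d → ℤ) (i : Fin d) => (v i : ℝ)) '' (A : Set (Fin d → ℤ)))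

/-!
Write `A = {a₀, …, a_{d+1}}` and let `M` be the `(d+1) × (d+2)` matrix with columns `(1, aⱼ)`. As
`A - A` generates `ℤ^d`, the matrix `M` has an integral right inverse, and this makes the vector `l`
of its signed maximal minors a generator of its kernel (`exists_eq_mul_signedMinors`): up to
multiples, `l` is the only affine relation between the elements of `A`. Put `r = ∑ max (lⱼ, 0)`.

An element of `hA` is the value `∑ xⱼ aⱼ` of a vector `x ∈ ℕ^(d+2)` with `∑ xⱼ = h`, and two such
vectors have the same value if and only if they differ by a multiple of `l`. Each class contains
exactly one vector that does not dominate the positive part of `l`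
(`card_image_piAntidiag_eq_card_filter`). So `|hA|` is the number of all vectors, minus the number
of those that dominate the positive part of `l`; translation by the positive part identifies the
latter with the vectors of coordinate sum `h - r`, and both are binomial coefficients.

The same argument with real coefficients triangulates the hull: a point `∑ tⱼ aⱼ` can be moved along
`l` until some coefficient at an index with `lᵢ > 0` vanishes
(`convexHull_range_eq_biUnion_facets`), and any two of the simplices `conv {aⱼ : j ≠ i}` with
`lᵢ > 0` overlap in a null set (`aedisjoint_facets`). The simplex omitting `aᵢ` has volume
`|lᵢ| / d!` because `lᵢ` is, up to sign, the determinant of the remaining columns of `M`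
(`volume_convexHull_range`). Summing over `lᵢ > 0` gives `vol(Δ_A) · d! = r`.
-/

/-! ### The kernel of a surjective `n × (n + 1)` matrix -/

/-- The vector of signed maximal minors of an `n × (n + 1)` matrix. -/
def signedMinors {R : Type*} [CommRing R] {n : ℕ} (M : Matrix (Fin n) (Fin (n + 1)) R)
    (j : Fin (n + 1)) : R :=
  (-1) ^ (j : ℕ) * (M.submatrix id j.succAbove).det

section SignedMinors

variable {R : Type*} [CommRing R] {n : ℕ} (M : Matrix (Fin n) (Fin (n + 1)) R)

/-- Laplace expansion: the signed minors are the cofactors of a row put on top of `M`. -/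
lemma det_cons_eq_sum_signedMinors (w : Fin (n + 1) → R) :
    (Matrix.of (Fin.cons w (Matrix.of.symm M) : Fin (n + 1) → Fin (n + 1) → R)).det =
      ∑ j, w j * signedMinors M j := by
  rw [Matrix.det_succ_row_zero]
  refine Finset.sum_congr rfl fun j _ => ?_
  have : (Matrix.of (Fin.cons w (Matrix.of.symm M) : Fin (n + 1) → Fin (n + 1) → R)).submatrix Fin.succ
      j.succAbove = M.submatrix id j.succAbove := by
    ext i k; simp
  rw [this, signedMinors, Matrix.of_apply, Fin.cons_zero]
  ring

/-- Each entry is the determinant of `M` with one of its own rows repeated on top. -/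
lemma mulVec_signedMinors : M.mulVec (signedMinors M) = 0 := by
  ext i
  have h := det_cons_eq_sum_signedMinors M fun j => M i j
  rw [Matrix.det_zero_of_row_eq (Fin.succ_ne_zero i).symm (by funext j; simp)] at h
  simpa [Matrix.mulVec, dotProduct] using h.symm

/-- If `M` has a right inverse, its kernel is spanned by its signed maximal minors. With `N` the
matrix `M` with a row `w` put on top, and `T` the right inverse with the kernel vector `x` put in
front, `N * T` is block triangular with determinant `w ⬝ᵥ x`, whereas `det T` does not depend
on `w`. -/
lemma exists_eq_mul_signedMinors {S : Matrix (Fin (n + 1)) (Fin n) R} (hS : M * S = 1)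
    {x : Fin (n + 1) → R} (hx : M.mulVec x = 0) : ∃ c, ∀ j, x j = c * signedMinors M j := by
  let T : Matrix (Fin (n + 1)) (Fin (n + 1)) R :=
    Matrix.of fun j => (Fin.cons (x j) (S j) : Fin (n + 1) → R)
  refine ⟨T.det, fun j => ?_⟩
  let N : Matrix (Fin (n + 1)) (Fin (n + 1)) R :=
    Matrix.of (Fin.cons (Pi.single j 1) (Matrix.of.symm M) : Fin (n + 1) → Fin (n + 1) → R)
  have hN : N.det = signedMinors M j := by
    simp [N, det_cons_eq_sum_signedMinors, Pi.single_apply]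
  have h00 : (N * T) 0 0 = x j := by
    simp [N, T, Matrix.mul_apply, Pi.single_apply]
  have hk0 : ∀ k : Fin n, (N * T) k.succ 0 = 0 := fun k => by
    simpa [N, T, Matrix.mul_apply, Matrix.mulVec, dotProduct] using congrFun hx k
  have hsub : (N * T).submatrix Fin.succ Fin.succ = 1 := by
    rw [← hS]
    ext k l
    simp [N, T, Matrix.mul_apply]
  have hdet : (N * T).det = x j := by
    rw [Matrix.det_succ_column_zero, Fin.sum_univ_succ]
    simp [h00, hk0, hsub]
  rw [← hdet, Matrix.det_mul, hN, mul_comm]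

/-- If the signed minors vanished, `M` would embed `R^(n+1)` into `R^n`. -/
lemma signedMinors_ne_zero [Nontrivial R] {S : Matrix (Fin (n + 1)) (Fin n) R} (hS : M * S = 1) :
    signedMinors M ≠ 0 := by
  intro h0
  have hinj : Function.Injective (Matrix.mulVecLin M) := by
    rw [← LinearMap.ker_eq_bot, LinearMap.ker_eq_bot']
    intro x hx
    obtain ⟨c, hc⟩ := exists_eq_mul_signedMinors M hS (x := x) (by simpa using hx)
    ext j
    simp [hc j, h0]
  have := card_le_of_injective R _ hinj
  simp at this

lemma map_signedMinors {R' : Type*} [CommRing R'] (f : R →+* R') (j : Fin (n + 1)) :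
    signedMinors (M.map f) j = f (signedMinors M j) := by
  rw [signedMinors, signedMinors, map_mul, map_pow, map_neg, map_one, RingHom.map_det]
  rfl

end SignedMinors

/-- The matrix whose columns are the points `p j`, each lifted to height `1` by a new
zeroth coordinate. -/
def liftMatrix {R : Type*} [One R] {n m : ℕ} (p : Fin m → Fin n → R) :
    Matrix (Fin (n + 1)) (Fin m) R :=
  Matrix.of fun i j => (Fin.cons 1 (p j) : Fin (n + 1) → R) i

lemma liftMatrix_mulVec_eq {R : Type*} [CommRing R] {n m : ℕ} (p : Fin m → Fin n → R)
    (x : Fin m → R) :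
    (liftMatrix p).mulVec x = (Fin.cons (∑ j, x j) (∑ j, x j • p j) : Fin (n + 1) → R) := by
  ext i
  refine Fin.cases ?_ (fun i => ?_) i
  · simp [liftMatrix, Matrix.mulVec, dotProduct]
  · simp [liftMatrix, Matrix.mulVec, dotProduct, mul_comm]

lemma liftMatrix_mulVec_eq_zero_iff {R : Type*} [CommRing R] {n m : ℕ} (p : Fin m → Fin n → R)
    (x : Fin m → R) :
    (liftMatrix p).mulVec x = 0 ↔ ∑ j, x j = 0 ∧ ∑ j, x j • p j = 0 := by
  rw [liftMatrix_mulVec_eq, funext_iff, Fin.forall_fin_succ, funext_iff]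
  simp

/-- Every vector of `ℤ^(n+1)` is an integral combination of the lifted points as soon as the
differences of the points generate `ℤ^n`. -/
lemma exists_liftMatrix_mul_eq_one {n m : ℕ} (p : Fin (m + 1) → Fin n → ℤ)
    (hp : AddSubgroup.closure (Set.range p - Set.range p) = ⊤) :
    ∃ S : Matrix (Fin (m + 1)) (Fin (n + 1)) ℤ, liftMatrix p * S = 1 := by
  have key : ∀ v : Fin n → ℤ, ∃ y : Fin (m + 1) → ℤ, ∑ j, y j = 0 ∧ ∑ j, y j • p j = v := by
    intro v
    have hv : v ∈ AddSubgroup.closure (Set.range p - Set.range p) := hp ▸ AddSubgroup.mem_top v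
    induction hv using AddSubgroup.closure_induction with
    | mem v hv =>
      obtain ⟨_, ⟨i, rfl⟩, _, ⟨j, rfl⟩, rfl⟩ := hv
      refine ⟨Pi.single i 1 - Pi.single j 1, ?_, ?_⟩
      · simp [Finset.sum_sub_distrib]
      · simp [sub_smul, Finset.sum_sub_distrib, Pi.single_apply, ite_smul]
    | zero => exact ⟨0, by simp, by simp⟩
    | add v w _ _ hv hw =>
      obtain ⟨y, hy, rfl⟩ := hv
      obtain ⟨z, hz, rfl⟩ := hw
      exact ⟨y + z, by simp [Finset.sum_add_distrib, hy, hz],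
        by simp [add_smul, Finset.sum_add_distrib]⟩
    | neg v _ hv =>
      obtain ⟨y, hy, rfl⟩ := hv
      exact ⟨-y, by simp [hy], by simp⟩
  have surj : ∀ u : Fin (n + 1) → ℤ, ∃ y, (liftMatrix p).mulVec y = u := by
    intro u
    obtain ⟨y, hy, hyv⟩ := key (Fin.tail u - u 0 • p 0)
    refine ⟨y + Pi.single 0 (u 0), ?_⟩
    rw [liftMatrix_mulVec_eq, ← Fin.cons_self_tail u]
    congr 1
    · simp [Finset.sum_add_distrib, hy]
    · simp only [Pi.add_apply, add_smul, Finset.sum_add_distrib, hyv, Pi.single_apply, ite_smul,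
        zero_smul, Finset.sum_ite_eq', Finset.mem_univ, if_true, Fin.cons_zero, sub_add_cancel]
  choose y hy using fun i : Fin (n + 1) => surj (Pi.single i 1)
  refine ⟨Matrix.of fun j i => y i j, ?_⟩
  ext i k
  have := congrFun (hy k) i
  simpa [Matrix.mul_apply, Matrix.mulVec, dotProduct, Matrix.one_apply, Pi.single_apply] using this

/-! ### Multiplicity vectors modulo an integral relation -/

lemma card_piAntidiag_univ_fin (m h : ℕ) :
    (Finset.piAntidiag (Finset.univ : Finset (Fin (m + 1))) h).card = (h + m).choose m := by
  classical
  rw [← Finset.map_sym_eq_piAntidiag, Finset.card_map, Finset.sym_univ, Finset.card_univ,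
    Sym.card_sym_eq_choose, Fintype.card_fin, show m + 1 + h - 1 = h + m by omega,
    Nat.choose_symm_add]

section Counting

variable {ι : Type*} [Fintype ι] [DecidableEq ι] {β : Type*} [DecidableEq β]

/-- If the fibres of `f` on `{x ∈ ℕ^ι : ∑ x = h}` are the classes modulo `ℤ l`, then every fibre
has exactly one element that does not dominate the positive part of `l`: subtract `l` as long
as this leaves a nonnegative vector. -/
lemma card_image_piAntidiag_eq_card_filter (l : ι → ℤ) (hl : ∑ j, l j = 0) (hl0 : l ≠ 0) (h : ℕ)
    (f : (ι → ℕ) → β)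
    (hf : ∀ x y : ι → ℕ, ∑ j, x j = ∑ j, y j →
      (f x = f y ↔ ∃ c : ℤ, ∀ j, (x j : ℤ) - y j = c * l j)) :
    ((Finset.piAntidiag Finset.univ h).image f).card =
      ((Finset.piAntidiag Finset.univ h).filter fun x => ¬ ∀ j, (l j).toNat ≤ x j).card := by
  obtain ⟨i, hi⟩ : ∃ i, 0 < l i := by
    by_contra! hneg
    refine hl0 (funext fun j => ?_)
    exact (Finset.sum_eq_zero_iff_of_nonpos fun j _ => hneg j).1 hl j (Finset.mem_univ j)
  have himage : (Finset.piAntidiag Finset.univ h).image f =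
      ((Finset.piAntidiag Finset.univ h).filter fun x => ¬ ∀ j, (l j).toNat ≤ x j).image f := by
    refine Finset.Subset.antisymm ?_ (Finset.image_subset_image (Finset.filter_subset _ _))
    have key : ∀ k : ℕ, ∀ x : ι → ℕ, x i = k → ∑ j, x j = h →
        ∃ y : ι → ℕ, ∑ j, y j = h ∧ (¬ ∀ j, (l j).toNat ≤ y j) ∧ f y = f x := by
      intro k
      induction k using Nat.strong_induction_on with
      | _ k ih =>
        intro x hxk hxh
        by_cases hx : ∀ j, (l j).toNat ≤ x j
        · have hxl : ∀ j, (((x j : ℤ) - l j).toNat : ℤ) = x j - l j := fun j => by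
            have := hx j; omega
          have hsum : ∑ j, ((x j : ℤ) - l j).toNat = h := by
            zify
            simp only [hxl, Finset.sum_sub_distrib, hl, sub_zero]
            exact_mod_cast hxh
          have hlt : ((x i : ℤ) - l i).toNat < k := by
            have := hx i; omega
          obtain ⟨y, hy, hyl, hyf⟩ := ih _ hlt (fun j => ((x j : ℤ) - l j).toNat) rfl hsum
          refine ⟨y, hy, hyl, hyf.trans ?_⟩
          rw [hf _ _ (hsum.trans hxh.symm)]
          exact ⟨-1, fun j => by rw [hxl]; ring⟩
        · exact ⟨x, hxh, hx, rfl⟩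
    intro b hb
    obtain ⟨x, hx, rfl⟩ := Finset.mem_image.1 hb
    obtain ⟨y, hy, hyl, hyf⟩ := key _ x rfl (Finset.mem_piAntidiag.1 hx).1
    exact Finset.mem_image.2 ⟨y, by simpa [hy] using hyl, hyf⟩
  have hdom : ∀ x y : ι → ℕ, ∀ c : ℤ, 0 < c → (∀ j, (x j : ℤ) - y j = c * l j) →
      ∀ j, (l j).toNat ≤ x j := by
    intro x y c hc hxy j
    rcases le_or_gt (l j) 0 with hj | hj
    · simp [Int.toNat_of_nonpos hj]
    · have h1 : l j ≤ c * l j := le_mul_of_one_le_left hj.le hc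
      have := hxy j
      omega
  rw [himage, Finset.card_image_of_injOn]
  intro x hx y hy hxy
  simp only [Finset.coe_filter, Finset.mem_piAntidiag, Set.mem_ofPred_eq] at hx hy
  obtain ⟨c, hc⟩ := (hf x y (hx.1.1.trans hy.1.1.symm)).1 hxy
  rcases lt_trichotomy c 0 with h0 | rfl | h0
  · refine absurd (hdom y x (-c) (by omega) fun j => ?_) hy.2
    linear_combination -hc j
  · funext j
    have := hc j
    omega
  · exact absurd (hdom x y c h0 hc) hx.2

lemma card_filter_le_piAntidiag_of_lt (u : ι → ℕ) {h : ℕ} (hu : h < ∑ j, u j) :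
    ((Finset.piAntidiag Finset.univ h).filter fun x => ∀ j, u j ≤ x j).card = 0 := by
  rw [Finset.card_eq_zero, Finset.filter_eq_empty_iff]
  intro x hx hux
  have h1 : ∑ j, x j = h := (Finset.mem_piAntidiag.1 hx).1
  have h2 := Finset.sum_le_sum fun j (_ : j ∈ Finset.univ) => hux j
  omega

lemma card_filter_le_piAntidiag (u : ι → ℕ) {h : ℕ} (hu : ∑ j, u j ≤ h) :
    ((Finset.piAntidiag Finset.univ h).filter fun x => ∀ j, u j ≤ x j).card =
      (Finset.piAntidiag (Finset.univ : Finset ι) (h - ∑ j, u j)).card := by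
  symm
  refine Finset.card_bij (fun x _ => x + u) (fun x hx => ?_) (fun x _ y _ hxy => ?_)
    fun y hy => ?_
  · have h1 := (Finset.mem_piAntidiag.1 hx).1
    simp only [Finset.mem_filter, Finset.mem_piAntidiag]
    refine ⟨⟨?_, by simp⟩, by simp⟩
    simp only [Pi.add_apply, Finset.sum_add_distrib, h1]
    omega
  · exact add_right_cancel hxy
  · simp only [Finset.mem_filter, Finset.mem_piAntidiag] at hy
    refine ⟨y - u, ?_, funext fun j => Nat.sub_add_cancel (hy.2 j)⟩
    simp only [Finset.mem_piAntidiag]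
    refine ⟨?_, by simp⟩
    simp only [Pi.sub_apply]
    rw [Finset.sum_tsub_distrib _ fun j _ => hy.2 j, hy.1.1]

lemma card_image_piAntidiag_add (l : ι → ℤ) (hl : ∑ j, l j = 0) (hl0 : l ≠ 0) (h : ℕ)
    (f : (ι → ℕ) → β)
    (hf : ∀ x y : ι → ℕ, ∑ j, x j = ∑ j, y j →
      (f x = f y ↔ ∃ c : ℤ, ∀ j, (x j : ℤ) - y j = c * l j)) :
    ((Finset.piAntidiag Finset.univ h).image f).card +
        (if ∑ j, (l j).toNat ≤ h then
          (Finset.piAntidiag (Finset.univ : Finset ι) (h - ∑ j, (l j).toNat)).card else 0) =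
      (Finset.piAntidiag (Finset.univ : Finset ι) h).card := by
  rw [card_image_piAntidiag_eq_card_filter l hl hl0 h f hf,
    ← Finset.card_filter_add_card_filter_not (s := Finset.piAntidiag Finset.univ h)
      fun x => ∀ j, (l j).toNat ≤ x j, add_comm]
  congr 1
  split_ifs with hr
  · exact (card_filter_le_piAntidiag _ hr).symm
  · exact (card_filter_le_piAntidiag_of_lt _ (not_le.1 hr)).symm

end Counting

/-- The `h`-fold sumset in terms of multiplicities of the elements of `A`. -/
lemma foldSumset_eq_image {d : ℕ} {ι : Type*} [Fintype ι] [DecidableEq ι]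
    (A : Finset (Fin d → ℤ)) (a : ι → Fin d → ℤ) (ha : Set.range a = A) (h : ℕ) :
    foldSumset h A =
      (Finset.piAntidiag Finset.univ h).image fun x : ι → ℕ => ∑ j, x j • a j := by
  ext v
  simp only [foldSumset, Finset.mem_image, Fintype.mem_piFinset, Finset.mem_piAntidiag]
  constructor
  · rintro ⟨b, hb, rfl⟩
    have hb' : ∀ k, ∃ j, a j = b k := fun k => by
      have : b k ∈ Set.range a := ha ▸ hb k
      exact this
    choose g hg using hb'
    refine ⟨fun j => (Finset.univ.filter fun k => g k = j).card, ⟨?_, by simp⟩, ?_⟩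
    · rw [← Finset.card_eq_sum_card_fiberwise fun k _ => Finset.mem_coe.2 (Finset.mem_univ (g k))]
      simp
    · rw [← Finset.sum_fiberwise Finset.univ g]
      refine Finset.sum_congr rfl fun j _ => ?_
      rw [← Finset.sum_const]
      exact Finset.sum_congr rfl fun k hk => by rw [← hg, (Finset.mem_filter.1 hk).2]
  · rintro ⟨x, ⟨hx, -⟩, rfl⟩
    have hcard : Fintype.card (Σ j, Fin (x j)) = h := by simp [hx]
    let e := Fintype.equivFinOfCardEq hcard
    refine ⟨fun k => a (e.symm k).1, fun k => ?_, ?_⟩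
    · have : a (e.symm k).1 ∈ (A : Set (Fin d → ℤ)) := ha ▸ Set.mem_range_self _
      exact this
    · rw [Equiv.sum_comp e.symm fun s : Σ j, Fin (x j) => a s.1, Fintype.sum_sigma]
      simp

/-! ### Volumes of simplices -/

open MeasureTheory in
/-- Slicing by the zeroth coordinate `t` leaves corner simplices of size `s - t`. -/
lemma volume_corner_simplex (n : ℕ) {s : ℝ} (hs : 0 ≤ s) :
    volume {x : Fin n → ℝ | (∀ i, 0 ≤ x i) ∧ ∑ i, x i ≤ s} =
      ENNReal.ofReal (s ^ n / n.factorial) := by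
  induction n generalizing s with
  | zero => simp [hs, volume_pi]
  | succ n ih =>
    let E : Set (ℝ × (Fin n → ℝ)) := {q | 0 ≤ q.1 ∧ (∀ i, 0 ≤ q.2 i) ∧ q.1 + ∑ i, q.2 i ≤ s}
    have hE : MeasurableSet E := by
      have hE' : E = {q | 0 ≤ q.1} ∩ ((⋂ i, {q | 0 ≤ q.2 i}) ∩ {q | q.1 + ∑ i, q.2 i ≤ s}) := by
        ext q
        simp [E]
      rw [hE']
      refine IsClosed.measurableSet (.inter ?_ (.inter (isClosed_iInter fun i => ?_) ?_)) <;>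
        exact isClosed_le (by fun_prop) (by fun_prop)
    have hpre : {x : Fin (n + 1) → ℝ | (∀ i, 0 ≤ x i) ∧ ∑ i, x i ≤ s} =
        MeasurableEquiv.piFinSuccAbove (fun _ => ℝ) 0 ⁻¹' E := by
      ext x
      simp [E, Fin.forall_fin_succ, Fin.sum_univ_succ, Fin.tail, and_assoc]
    have hslice : ∀ t : ℝ, volume (Prod.mk t ⁻¹' E) =
        (Set.Icc 0 s).indicator (fun t => ENNReal.ofReal ((s - t) ^ n / n.factorial)) t := by
      intro t
      by_cases ht : t ∈ Set.Icc 0 s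
      · rw [Set.indicator_of_mem ht, ← ih (sub_nonneg.2 ht.2)]
        congr 1
        ext x
        simp [E, ht.1, le_sub_iff_add_le']
      · rw [Set.indicator_of_notMem ht]
        convert measure_empty (μ := (volume : Measure (Fin n → ℝ)))
        refine Set.eq_empty_iff_forall_notMem.2 fun x hx => ht ⟨hx.1, ?_⟩
        have : 0 ≤ ∑ i, x i := Finset.sum_nonneg fun i _ => hx.2.1 i
        linarith [hx.2.2]
    rw [hpre, (volume_preserving_piFinSuccAbove (fun _ => ℝ) 0).measure_preimage
      hE.nullMeasurableSet, Measure.volume_eq_prod, Measure.prod_apply hE]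
    simp_rw [hslice]
    rw [lintegral_indicator measurableSet_Icc, ← ofReal_integral_eq_lintegral_ofReal]
    · rw [integral_Icc_eq_integral_Ioc, ← intervalIntegral.integral_of_le hs,
        intervalIntegral.integral_div,
        intervalIntegral.integral_comp_sub_left (fun t => t ^ n) s, integral_pow,
        Nat.factorial_succ]
      congr 1
      push_cast
      field_simp
      simp
    · exact Continuous.integrableOn_Icc (by fun_prop)
    · refine (ae_restrict_iff' measurableSet_Icc).2 (.of_forall fun t ht => ?_)
      exact div_nonneg (pow_nonneg (sub_nonneg.2 ht.2) _) (by positivity)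

lemma convexHull_range_eq_image_stdSimplex {ι E : Type*} [Fintype ι] [AddCommGroup E]
    [Module ℝ E] (p : ι → E) :
    convexHull ℝ (Set.range p) = (fun t : ι → ℝ => ∑ j, t j • p j) '' stdSimplex ℝ ι := by
  classical
  have := (Fintype.linearCombination ℝ p).image_convexHull (Set.range fun i : ι => Pi.single i 1)
  rw [convexHull_rangle_single_eq_stdSimplex, ← Set.range_comp] at this
  convert this.symm using 2
  · congr 1
    ext i
    simp [Fintype.linearCombination_apply, Pi.single_apply]
  · simp [Fintype.linearCombination_apply]

/-- Subtracting the zeroth column from all others. -/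
lemma det_liftMatrix {R : Type*} [CommRing R] {d : ℕ} (p : Fin (d + 1) → Fin d → R) :
    (liftMatrix p).det = (Matrix.of fun i j : Fin d => p j.succ i - p 0 i).det := by
  let B : Matrix (Fin (d + 1)) (Fin (d + 1)) R := Matrix.of fun i j =>
    (Fin.cons (liftMatrix p i 0) (fun k : Fin d => liftMatrix p i k.succ - liftMatrix p i 0) :
      Fin (d + 1) → R) j
  have h1 : (liftMatrix p).det = B.det := by
    rw [← Matrix.det_transpose, ← Matrix.det_transpose B]
    refine Matrix.det_eq_of_forall_row_eq_smul_add_const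
      (Fin.cons 0 fun _ => 1 : Fin (d + 1) → R) 0 (by simp) fun j i => ?_
    refine Fin.cases ?_ (fun j => ?_) j <;> simp [B]
  rw [h1, Matrix.det_succ_row_zero, Fin.sum_univ_succ]
  simp only [B, liftMatrix, Matrix.of_apply, Fin.cons_zero, Fin.cons_succ, sub_self, mul_zero,
    zero_mul, Finset.sum_const_zero, add_zero, Fin.val_zero, pow_zero, one_mul]
  congr 1

open MeasureTheory in
/-- The simplex is an affine image of the corner simplex; if it is degenerate, both sides
vanish. -/
lemma volume_convexHull_range {d : ℕ} (p : Fin (d + 1) → Fin d → ℝ) :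
    volume (convexHull ℝ (Set.range p)) =
      ENNReal.ofReal (|(liftMatrix p).det| / d.factorial) := by
  let B : Matrix (Fin d) (Fin d) ℝ := Matrix.of fun i j => p j.succ i - p 0 i
  let C : Set (Fin d → ℝ) := {x | (∀ i, 0 ≤ x i) ∧ ∑ i, x i ≤ 1}
  have hB : ∀ x : Fin d → ℝ, p 0 + Matrix.toLin' B x =
      (1 - ∑ i, x i) • p 0 + ∑ i, x i • p i.succ := by
    intro x
    ext i
    simp only [B, Matrix.toLin'_apply, Matrix.mulVec, dotProduct, Matrix.of_apply, Pi.add_apply,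
      Pi.smul_apply, smul_eq_mul, Finset.sum_apply, sub_mul, Finset.sum_sub_distrib,
      mul_comm (p _ i)]
    simp only [Finset.sum_mul]
    ring
  have himage : convexHull ℝ (Set.range p) = (p 0 + ·) '' (Matrix.toLin' B '' C) := by
    rw [convexHull_range_eq_image_stdSimplex, Set.image_image]
    ext v
    constructor
    · rintro ⟨t, ht, rfl⟩
      have hsum := ht.2
      rw [Fin.sum_univ_succ] at hsum
      refine ⟨fun i => t i.succ, ⟨fun i => ht.1 _, by linarith [ht.1 0]⟩, ?_⟩
      simp only [hB, Fin.sum_univ_succ]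
      rw [← hsum, add_sub_cancel_right]
    · rintro ⟨x, hx, rfl⟩
      refine ⟨(Fin.cons (1 - ∑ i, x i) x : Fin (d + 1) → ℝ), ⟨?_, ?_⟩, ?_⟩
      · exact Fin.cases (by simpa using hx.2) fun i => by simpa using hx.1 i
      · simp [Fin.sum_univ_succ]
      · simp only [hB, Fin.sum_univ_succ, Fin.cons_zero, Fin.cons_succ]
  rw [himage, Set.image_add_left, measure_preimage_add, Measure.addHaar_image_linearMap,
    LinearMap.det_toLin', volume_corner_simplex d zero_le_one, det_liftMatrix,
    ← ENNReal.ofReal_mul (abs_nonneg _), one_pow, mul_one_div]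

open MeasureTheory in
/-- Any `d` points of `ℝ^d` lie in a proper affine subspace. -/
lemma volume_convexHull_image_eq_zero {d : ℕ} {ι : Type*} (p : ι → Fin d → ℝ) (s : Finset ι)
    (hs : s.card = d) : volume (convexHull ℝ (p '' (s : Set ι))) = 0 := by
  classical
  refine measure_mono_null (convexHull_subset_affineSpan _) (Measure.addHaar_affineSubspace _ _ ?_)
  intro htop
  rcases Nat.eq_zero_or_pos d with rfl | hd
  · rw [Finset.card_eq_zero] at hs
    subst hs
    simp at htop
  · have h1 := finrank_vectorSpan_image_finset_le ℝ p s (n := d - 1) (by omega)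
    rw [Finset.coe_image, ← direction_affineSpan, htop, AffineSubspace.direction_top,
      finrank_top] at h1
    simp at h1
    omega

/-! ### Triangulating the convex hull of `d + 2` points -/

section Triangulation

variable {d : ℕ} (p : Fin (d + 2) → Fin d → ℝ)

/-- The hull of all points but `p i`, in terms of coefficient vectors on all points. -/
lemma convexHull_facet_eq (i : Fin (d + 2)) :
    convexHull ℝ (Set.range (p ∘ i.succAbove)) =
      {v | ∃ t ∈ stdSimplex ℝ (Fin (d + 2)), t i = 0 ∧ ∑ j, t j • p j = v} := by
  rw [convexHull_range_eq_image_stdSimplex]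
  ext v
  constructor
  · rintro ⟨t, ht, rfl⟩
    refine ⟨i.insertNth 0 t, ⟨fun j => ?_, ?_⟩, by simp, ?_⟩
    · refine Fin.succAboveCases i ?_ (fun j => ?_) j
      · simp
      · simpa using ht.1 j
    · simpa [Fin.sum_univ_succAbove _ i] using ht.2
    · simp [Fin.sum_univ_succAbove _ i]
  · rintro ⟨t, ht, hti, rfl⟩
    refine ⟨fun j => t (i.succAbove j), ⟨fun j => ht.1 _, ?_⟩, ?_⟩
    · simpa [Fin.sum_univ_succAbove _ i, hti] using ht.2
    · simp [Fin.sum_univ_succAbove _ i, hti]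

/-- Moving along an affine dependence `l` until a coefficient of an index with `0 < l i` vanishes
puts every point of the hull into one of the simplices that omit such an index. -/
lemma convexHull_range_eq_biUnion_facets {l : Fin (d + 2) → ℝ} (hl : ∑ j, l j = 0)
    (hlp : ∑ j, l j • p j = 0) (hl0 : l ≠ 0) :
    convexHull ℝ (Set.range p) =
      ⋃ i ∈ Finset.univ.filter fun i => 0 < l i, convexHull ℝ (Set.range (p ∘ i.succAbove)) := by
  refine Set.Subset.antisymm ?_ (Set.iUnion₂_subset fun i _ =>
    convexHull_mono (Set.range_comp_subset_range _ _))
  rw [convexHull_range_eq_image_stdSimplex]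
  rintro _ ⟨t, ht, rfl⟩
  have hne : (Finset.univ.filter fun i => 0 < l i).Nonempty := by
    rw [Finset.filter_nonempty_iff]
    by_contra! hneg
    refine hl0 (funext fun j => ?_)
    exact (Finset.sum_eq_zero_iff_of_nonpos fun j hj => hneg j hj).1 hl j (Finset.mem_univ j)
  obtain ⟨i, hi, hmin⟩ := Finset.exists_min_image _ (fun i => t i / l i) hne
  simp only [Finset.mem_filter, Finset.mem_univ, true_and] at hi hmin
  refine Set.mem_iUnion₂.2 ⟨i, by simpa using hi, ?_⟩
  rw [convexHull_facet_eq]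
  refine ⟨fun j => t j - t i / l i * l j, ⟨fun j => sub_nonneg.2 ?_, ?_⟩, ?_, ?_⟩
  · rcases le_or_gt (l j) 0 with hj | hj
    · exact (mul_nonpos_of_nonneg_of_nonpos (div_nonneg (ht.1 i) hi.le) hj).trans (ht.1 j)
    · exact (le_div_iff₀ hj).1 (hmin j hj)
  · rw [Finset.sum_sub_distrib, ← Finset.mul_sum, hl, mul_zero, sub_zero, ht.2]
  · field_simp
    simp
  · simp only [sub_smul, mul_smul, Finset.sum_sub_distrib, ← Finset.smul_sum, hlp, smul_zero,
      sub_zero]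

open MeasureTheory in
/-- Two simplices of the triangulation meet in the common face omitting both indices: the
coefficient vectors of a common point differ by a multiple of `l`, and positivity of `l` at both
omitted indices forces this multiple to be zero. -/
lemma aedisjoint_facets {l : Fin (d + 2) → ℝ}
    (hker : ∀ x : Fin (d + 2) → ℝ, ∑ j, x j = 0 → ∑ j, x j • p j = 0 → ∃ c, ∀ j, x j = c * l j)
    {i k : Fin (d + 2)} (hik : i ≠ k) (hi : 0 < l i) (hk : 0 < l k) :
    AEDisjoint volume (convexHull ℝ (Set.range (p ∘ i.succAbove)))
      (convexHull ℝ (Set.range (p ∘ k.succAbove))) := by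
  have hcard : (({i, k}ᶜ : Finset (Fin (d + 2)))).card = d := by
    rw [Finset.card_compl, Finset.card_pair hik, Fintype.card_fin, Nat.add_sub_cancel]
  refine measure_mono_null ?_ (volume_convexHull_image_eq_zero p _ hcard)
  rw [convexHull_facet_eq, convexHull_facet_eq]
  rintro _ ⟨⟨t, ht, hti, rfl⟩, ⟨u, hu, huk, htu⟩⟩
  obtain ⟨c, hc⟩ := hker (t - u) (by simp [Finset.sum_sub_distrib, ht.2, hu.2])
    (by simp [sub_smul, Finset.sum_sub_distrib, htu])
  have htk : t k = 0 := by
    have h1 := hc i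
    have h2 := hc k
    simp only [Pi.sub_apply, hti, huk, zero_sub, sub_zero] at h1 h2
    have hc0 : c ≤ 0 := by
      by_contra! hpos
      linarith [mul_pos hpos hi, hu.1 i]
    exact le_antisymm (h2 ▸ mul_nonpos_of_nonpos_of_nonneg hc0 hk.le) (ht.1 k)
  have hz : ∀ j, j ∉ ({i, k}ᶜ : Finset (Fin (d + 2))) → t j = 0 := by
    intro j hj
    rw [Finset.notMem_compl, Finset.mem_insert, Finset.mem_singleton] at hj
    rcases hj with rfl | rfl
    exacts [hti, htk]
  rw [← Finset.sum_subset (Finset.subset_univ ({i, k}ᶜ : Finset (Fin (d + 2))))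
    fun j _ hj => by rw [hz j hj, zero_smul]]
  refine (convex_convexHull ℝ _).sum_mem (fun j _ => ht.1 j) ?_ fun j hj =>
    subset_convexHull ℝ _ (Set.mem_image_of_mem p hj)
  rw [Finset.sum_subset (Finset.subset_univ _) fun j _ hj => hz j hj]
  exact ht.2

open MeasureTheory in
lemma volume_convexHull_eq_sum_signedMinors {S : Matrix (Fin (d + 2)) (Fin (d + 1)) ℝ}
    (hS : liftMatrix p * S = 1) :
    volume (convexHull ℝ (Set.range p)) =
      ∑ i with 0 < signedMinors (liftMatrix p) i,
        ENNReal.ofReal (signedMinors (liftMatrix p) i / d.factorial) := by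
  obtain ⟨hl, hlp⟩ := (liftMatrix_mulVec_eq_zero_iff p _).1 (mulVec_signedMinors (liftMatrix p))
  rw [convexHull_range_eq_biUnion_facets p hl hlp (signedMinors_ne_zero _ hS),
    measure_biUnion_finset₀]
  · refine Finset.sum_congr rfl fun i hi => ?_
    have hi' := (Finset.mem_filter.1 hi).2
    rw [volume_convexHull_range]
    congr 2
    rw [← abs_of_pos hi', signedMinors, abs_mul, abs_pow, abs_neg, abs_one, one_pow, one_mul]
    rfl
  · intro i hi k hk hik
    exact aedisjoint_facets p
      (fun x hx hxp => exists_eq_mul_signedMinors _ hS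
        ((liftMatrix_mulVec_eq_zero_iff p x).2 ⟨hx, hxp⟩))
      hik (Finset.mem_filter.1 hi).2 (Finset.mem_filter.1 hk).2
  · exact fun i _ =>
      ((Set.finite_range _).isClosed_convexHull ℝ).measurableSet.nullMeasurableSet

end Triangulation

/-! ### Volume of the hull and size of the sumsets -/

lemma volume_hull_mul_factorial {d : ℕ} (A : Finset (Fin d → ℤ)) (a : Fin (d + 2) → Fin d → ℤ)
    (ha : Set.range a = A) {S : Matrix (Fin (d + 2)) (Fin (d + 1)) ℤ}
    (hS : liftMatrix a * S = 1) :
    MeasureTheory.volume (hull A) * (d.factorial : ℝ≥0∞) =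
      ((∑ j, (signedMinors (liftMatrix a) j).toNat : ℕ) : ℝ≥0∞) := by
  let p : Fin (d + 2) → Fin d → ℝ := fun j i => a j i
  have hp : liftMatrix p = (liftMatrix a).map (Int.castRingHom ℝ) := by
    ext i j
    refine Fin.cases ?_ (fun i => ?_) i <;> simp [liftMatrix, p]
  have hS' : liftMatrix p * S.map (Int.castRingHom ℝ) = 1 := by
    rw [hp, ← Matrix.map_mul, hS]
    simp
  have hhull : hull A = convexHull ℝ (Set.range p) := by
    rw [hull, ← ha, ← Set.range_comp]
    rfl
  rw [hhull, volume_convexHull_eq_sum_signedMinors p hS', Finset.sum_mul, hp]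
  simp only [map_signedMinors, eq_intCast, Int.cast_pos]
  rw [Finset.sum_filter, Nat.cast_sum]
  refine Finset.sum_congr rfl fun j _ => ?_
  split_ifs with hj
  · rw [← ENNReal.ofReal_natCast d.factorial, ← ENNReal.ofReal_mul (by positivity),
      div_mul_cancel₀ _ (by positivity), ← ENNReal.ofReal_natCast]
    congr 1
    exact_mod_cast (Int.toNat_of_nonneg hj.le).symm
  · simp [Int.toNat_of_nonpos (not_lt.1 hj)]

/-- The size of `hA`: all multiplicity vectors, less those that dominate the positive part of the
signed minors. -/
lemma card_foldSumset_add {d : ℕ} (A : Finset (Fin d → ℤ)) (a : Fin (d + 2) → Fin d → ℤ)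
    (ha : Set.range a = A) {S : Matrix (Fin (d + 2)) (Fin (d + 1)) ℤ}
    (hS : liftMatrix a * S = 1) (h : ℕ) :
    (foldSumset h A).card +
        (if ∑ j, (signedMinors (liftMatrix a) j).toNat ≤ h then
          (h - ∑ j, (signedMinors (liftMatrix a) j).toNat + (d + 1)).choose (d + 1) else 0) =
      (h + (d + 1)).choose (d + 1) := by
  obtain ⟨hl, hla⟩ := (liftMatrix_mulVec_eq_zero_iff a _).1 (mulVec_signedMinors (liftMatrix a))
  rw [foldSumset_eq_image A a ha, ← card_piAntidiag_univ_fin, ← card_piAntidiag_univ_fin]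
  refine card_image_piAntidiag_add (signedMinors (liftMatrix a)) hl (signedMinors_ne_zero _ hS) h
    (fun x => ∑ j, x j • a j) fun x y hxy => ?_
  have hsub : ∑ j, ((x j : ℤ) - y j) • a j = ∑ j, x j • a j - ∑ j, y j • a j := by
    simp only [sub_smul, Finset.sum_sub_distrib, natCast_zsmul]
  constructor
  · intro hf
    refine exists_eq_mul_signedMinors _ hS ((liftMatrix_mulVec_eq_zero_iff a _).2 ⟨?_, ?_⟩)
    · rw [Finset.sum_sub_distrib, sub_eq_zero]
      exact_mod_cast hxy
    · rw [hsub, hf, sub_self]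
  · rintro ⟨c, hc⟩
    rw [← sub_eq_zero, ← hsub]
    simp only [hc, mul_smul, ← Finset.smul_sum, hla, smul_zero]

/-- The number `r = vol(Δ_A) · d!` is a (finite) natural number, and it governs `|hA|`. -/
theorem theorem1p2 (d : ℕ) (A : Finset (Fin d → ℤ)) (hcard : A.card = d + 2)
    (hgen : AddSubgroup.closure ((A : Set (Fin d → ℤ)) - (A : Set (Fin d → ℤ))) = ⊤) :
    ∃ r : ℕ, MeasureTheory.volume (hull A) * (Nat.factorial d : ℝ≥0∞) = (r : ℝ≥0∞) ∧
      (∀ h : ℕ, h < r →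
        (foldSumset h A).card = Nat.choose (h + d + 1) (d + 1)) ∧
      (∀ h : ℕ, r ≤ h →
        ((foldSumset h A).card : ℤ) =
          (Nat.choose (h + d + 1) (d + 1) : ℤ) - (Nat.choose (h - r + d + 1) (d + 1) : ℤ)) := by
  obtain ⟨a, ha⟩ : ∃ a : Fin (d + 2) → Fin d → ℤ, Set.range a = A := by
    let e := A.equivFinOfCardEq hcard
    refine ⟨fun j => e.symm j, ?_⟩
    rw [← Function.comp_def, Set.range_comp, e.symm.range_eq_univ, Set.image_univ,
      Subtype.range_coe]
  obtain ⟨S, hS⟩ := exists_liftMatrix_mul_eq_one a (by rw [ha, hgen])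
  refine ⟨∑ j, (signedMinors (liftMatrix a) j).toNat, volume_hull_mul_factorial A a ha hS, ?_, ?_⟩
  all_goals
    intro h hr
    have hsize := card_foldSumset_add A a ha hS h
    rw [← add_assoc, ← add_assoc] at hsize
  · rwa [if_neg (not_le.2 hr), add_zero] at hsize
  · rw [if_pos hr] at hsize
    rw [← hsize]
    push_cast
    ring
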